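/- Propositional sentences are built from atomic sentences $p_0,p_1,p_2,\dots$ with the connectives $\land,\lor,\to,\neg$, and $\mathsf{IPC}$ is the set of theorems of the intuitionistic propositional calculus. For an implicative lattice (that is, a Heyting algebra) $L$, $\mathsf{Th}(L)$ is the set of all sentences $\varphi$ such that $v(\varphi)=\mathbf 1$ for every $L$-valuation $v$, where $v$ interprets $\land,\lor,\to$ as the meet, the join and the implication of $L$, and $v(\neg\varphi)=v(\varphi)\to\mathbf 0$. For $d\in L$, $L[d,\mathbf 1]$ is the implicative lattice $\{a\in L: d\le a\}$ with the order of $L$; its least element is $d$. For a partial ordering $P$, $\mathcal O(P)$ is the set of up-sets of $P$ (sets $A\subseteq P$ such that $a\in A$ and $a\le b$ imply $b\in A$), which is an implicative lattice under inclusion. For an integer $n>0$, with $n=\{0,\dots,n-1\}$, let $P_n=(\wp(n),\supseteq)$ and $P_n^-=(\wp(n)\setminus\{\emptyset\},\supseteq)$, and let $\mathbf O_n$ and $\mathbf O_n^-$ be the implicative lattices $\mathcal O(P_n)$ and $\mathcal O(P_n^-)$. Then \[ \bigcap_{n>0}\ \bigcap_{D\in\mathcal O(P_n)}\mathsf{Th}\bigl(\mathbf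 O_n[D,\mathbf 1]\bigr)\;=\;\mathsf{IPC}\;=\;\bigcap_{n>0}\ \bigcap_{D\in\mathcal O(P_n^-)}\mathsf{Th}\bigl(\mathbf O_n^-[D,\mathbf 1]\bigr). \] -/

import Mathlib

namespace IntProp

/-- Propositional sentences over the atomic sentences `p₀, p₁, p₂, …`, with the primitive
connectives `∧`, `∨`, `→` and `¬`. -/
inductive Sentence : Type
  | atom : ℕ → Sentence
  | and : Sentence → Sentence → Sentence
  | or : Sentence → Sentence → Sentence
  | imp : Sentence → Sentence → Sentence
  | neg : Sentence → Sentence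

/-- Derivability in the intuitionistic propositional calculus, as the usual Hilbert calculus:
axiom schemes and modus ponens. -/
inductive Provable : Sentence → Prop
  | imp_k (φ ψ : Sentence) : Provable (φ.imp (ψ.imp φ))
  | imp_s (φ ψ χ : Sentence) :
      Provable ((φ.imp (ψ.imp χ)).imp ((φ.imp ψ).imp (φ.imp χ)))
  | and_left (φ ψ : Sentence) : Provable ((φ.and ψ).imp φ)
  | and_right (φ ψ : Sentence) : Provable ((φ.and ψ).imp ψ)
  | and_intro (φ ψ : Sentence) : Provable (φ.imp (ψ.imp (φ.and ψ)))
  | or_left (φ ψ : Sentence) : Provable (φ.imp (φ.or ψ))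
  | or_right (φ ψ : Sentence) : Provable (ψ.imp (φ.or ψ))
  | or_elim (φ ψ χ : Sentence) :
      Provable ((φ.imp χ).imp ((ψ.imp χ).imp ((φ.or ψ).imp χ)))
  | neg_intro (φ ψ : Sentence) :
      Provable ((φ.imp ψ).imp ((φ.imp ψ.neg).imp φ.neg))
  | neg_elim (φ ψ : Sentence) : Provable (φ.neg.imp (φ.imp ψ))
  | mp {φ ψ : Sentence} : Provable (φ.imp ψ) → Provable φ → Provable ψ

/-- `IPC`: the set of theorems of the intuitionistic propositional calculus. -/
def IPC : Set Sentence := {φ | Provable φ}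

/-- The valuation of all sentences in an implicative lattice (Heyting algebra) determined by
the values `v i` of the atomic sentences; a negation has the value `a ⇨ ⊥`. -/
def Sentence.val {L : Type*} [HeytingAlgebra L] (v : ℕ → L) : Sentence → L
  | .atom i => v i
  | .and φ ψ => φ.val v ⊓ ψ.val v
  | .or φ ψ => φ.val v ⊔ ψ.val v
  | .imp φ ψ => φ.val v ⇨ ψ.val v
  | .neg φ => φ.val v ⇨ ⊥

/-- `Th(L)`: the sentences that every `L`-valuation sends to the greatest element. -/
def Th (L : Type*) [HeytingAlgebra L] : Set Sentence :=
  {φ | ∀ v : ℕ → L, φ.val v = ⊤}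

/-- The interval `L[d, 1] = {a ∈ L | d ≤ a}` (with the order of `L`) is an implicative lattice,
with least element `d` and with the meet, join, greatest element and implication of `L`. -/
instance instHeytingAlgebraIci {L : Type*} [HeytingAlgebra L] (d : L) :
    HeytingAlgebra (Set.Ici d) :=
  { Set.Ici.lattice, (Set.Ici.boundedOrder : BoundedOrder (Set.Ici d)) with
    himp := fun a b => ⟨(a : L) ⇨ (b : L), le_trans b.2 le_himp⟩
    compl := fun a => ⟨(a : L) ⇨ d, le_himp⟩
    le_himp_iff := fun a b c => le_himp_iff (a := (a : L)) (b := (b : L)) (c := (c : L))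
    himp_bot := fun _ => rfl }

/-- The carrier of `O(P)`: the up-sets of `P`. The order is inclusion. -/
abbrev OpenSets (P : Type*) [PartialOrder P] : Type _ := {A : Set P // IsUpperSet A}

/-- The implicative lattice `O(P)` of the up-sets of `P`, ordered by inclusion, with `∩`, `∪`,
`∅` and `P`; the implication `A ⇨ B` is the union of all up-sets `C` with `A ∩ C ⊆ B`. -/
instance instHeytingAlgebraOpenSets (P : Type*) [PartialOrder P] :
    HeytingAlgebra (OpenSets P) :=
  { (inferInstance : PartialOrder (OpenSets P)) with
    sup := fun A B => ⟨A.1 ∪ B.1, A.2.union B.2⟩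
    le_sup_left := fun _ _ => Set.subset_union_left
    le_sup_right := fun _ _ => Set.subset_union_right
    sup_le := fun _ _ _ h₁ h₂ => Set.union_subset h₁ h₂
    inf := fun A B => ⟨A.1 ∩ B.1, A.2.inter B.2⟩
    inf_le_left := fun _ _ => Set.inter_subset_left
    inf_le_right := fun _ _ => Set.inter_subset_right
    le_inf := fun _ _ _ h₁ h₂ => Set.subset_inter h₁ h₂
    top := ⟨Set.univ, isUpperSet_univ⟩
    le_top := fun A => Set.subset_univ A.1
    bot := ⟨∅, isUpperSet_empty⟩
    bot_le := fun A => Set.empty_subset A.1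
    himp := fun A B =>
      ⟨⋃₀ {C : Set P | IsUpperSet C ∧ A.1 ∩ C ⊆ B.1}, isUpperSet_sUnion fun _ hC => hC.1⟩
    le_himp_iff := fun A B C =>
      ⟨fun h x hx => by
          obtain ⟨D, hD, hxD⟩ := h hx.1
          exact hD.2 ⟨hx.2, hxD⟩,
        fun h => Set.subset_sUnion_of_mem
          ⟨A.2, fun x hx => h (show x ∈ A.1 ∩ B.1 from ⟨hx.2, hx.1⟩)⟩⟩
    compl := fun A =>
      ⟨⋃₀ {C : Set P | IsUpperSet C ∧ A.1 ∩ C ⊆ ∅}, isUpperSet_sUnion fun _ hC => hC.1⟩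
    himp_bot := fun _ => rfl }

/-- The partial ordering `P_n = (℘(n), ⊇)`. -/
abbrev Pow (n : ℕ) : Type := (Set (Fin n))ᵒᵈ

/-- The partial ordering `P_n⁻ = (℘(n) ∖ {∅}, ⊇)`. -/
abbrev PowMinus (n : ℕ) : Type := {s : Set (Fin n) // s.Nonempty}ᵒᵈ

/-- `O_n = O(P_n)`. -/
abbrev OpenPow (n : ℕ) : Type := OpenSets (Pow n)

/-- `O_n⁻ = O(P_n⁻)`. -/
abbrev OpenPowMinus (n : ℕ) : Type := OpenSets (PowMinus n)

end IntProp

/-!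
Soundness holds in every Heyting algebra, so only the two inclusions into `IPC` need an idea.

*Finite Kripke models.* If `φ` is not provable, some prime theory `T₀` omits `φ`. The traces `T ∩ Σ`
of the prime theories `T` on the finite set `Σ` of subformulas of `φ` that lie above `T₀ ∩ Σ` form,
ordered by inclusion, a finite partial order `F` with a least element, and the canonical valuation
refutes `φ` at that element (`exists_finite_countermodel`).

*The order complex.* Up-sets of `P` containing `D` are the same as up-sets of `P ∖ D`, so evaluating
sentences in `O(P)[D, 1]` is forcing on the frame `P ∖ D`. A map to `F` that is
monotone and has the back property (a p-morphism) transfers forcing (`mem_val_iff_forces`). Passing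
to complements, `P_n` is `℘(n)` ordered by inclusion, and its frames `P_n ∖ D` are the families
closed under subsets, that is, the simplicial complexes on `n` vertices. The chains of `F` form
such a complex, and sending a chain to its largest element (the empty chain to the least element of
`F`) is a p-morphism onto `F`: if `w` lies above the largest element of a chain, then adding `w` to
the chain produces a larger chain with largest element `w`. One vertex in addition to those of `F`
ensures that no chain is the set of all vertices, so the same construction lives in `P_n⁻`.
-/

namespace IntProp

/-! ### Soundness -/

/-- Every theorem of the intuitionistic calculus has value `⊤` in every Heyting algebra. -/
theorem Provable.val_eq_top {L : Type*} [HeytingAlgebra L] (v : ℕ → L) {φ : Sentence}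
    (h : Provable φ) : φ.val v = ⊤ := by
  induction h with
  | imp_k φ ψ => simp [Sentence.val]
  | imp_s φ ψ χ =>
    simp only [Sentence.val, himp_eq_top_iff]
    rw [le_himp_iff, le_himp_iff]
    generalize φ.val v = a, ψ.val v = b, χ.val v = c
    have h₁ : (a ⇨ b ⇨ c) ⊓ (a ⇨ b) ⊓ a ≤ b :=
      (inf_le_inf_right a inf_le_right).trans himp_inf_le
    have h₂ : (a ⇨ b ⇨ c) ⊓ (a ⇨ b) ⊓ a ≤ b ⇨ c :=
      (inf_le_inf_right a inf_le_left).trans himp_inf_le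
    exact (le_inf h₂ h₁).trans himp_inf_le
  | and_left φ ψ => simp [Sentence.val]
  | and_right φ ψ => simp [Sentence.val]
  | and_intro φ ψ =>
    simp only [Sentence.val, himp_eq_top_iff]
    rw [le_himp_iff]
  | or_left φ ψ => simp [Sentence.val]
  | or_right φ ψ => simp [Sentence.val]
  | or_elim φ ψ χ =>
    simp only [Sentence.val, himp_eq_top_iff]
    rw [le_himp_iff, sup_himp_distrib]
  | neg_intro φ ψ =>
    simp only [Sentence.val, himp_eq_top_iff]
    rw [le_himp_iff, le_himp_iff]
    generalize φ.val v = a, ψ.val v = b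
    have h₁ : (a ⇨ b) ⊓ (a ⇨ b ⇨ ⊥) ⊓ a ≤ b :=
      (inf_le_inf_right a inf_le_left).trans himp_inf_le
    have h₂ : (a ⇨ b) ⊓ (a ⇨ b ⇨ ⊥) ⊓ a ≤ b ⇨ ⊥ :=
      (inf_le_inf_right a inf_le_right).trans himp_inf_le
    exact (le_inf h₂ h₁).trans himp_inf_le
  | neg_elim φ ψ =>
    simp only [Sentence.val, himp_eq_top_iff]
    rw [le_himp_iff]
    exact himp_inf_le.trans bot_le
  | mp _ _ ih₁ ih₂ => simpa [Sentence.val, ih₂] using ih₁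

/-! ### Prime theories -/

/-- A theory: a set of sentences that contains the theorems of the calculus and is closed under
modus ponens. -/
structure IsTheory (T : Set Sentence) : Prop where
  provable {φ : Sentence} : Provable φ → φ ∈ T
  mp {φ ψ : Sentence} : φ.imp ψ ∈ T → φ ∈ T → ψ ∈ T

/-- A prime theory: a consistent theory with the disjunction property. Since contradictions imply
everything, consistency is stated as properness. -/
structure IsPrimeTheory (T : Set Sentence) : Prop extends IsTheory T where
  ne_univ : ∃ φ, φ ∉ T
  prime {φ ψ : Sentence} : φ.or ψ ∈ T → φ ∈ T ∨ ψ ∈ T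

theorem isTheory_IPC : IsTheory IPC := ⟨id, Provable.mp⟩

theorem Provable.imp_self (φ : Sentence) : Provable (φ.imp φ) :=
  .mp (.mp (.imp_s φ (φ.imp φ) φ) (.imp_k φ (φ.imp φ))) (.imp_k φ φ)

namespace IsTheory

variable {T : Set Sentence}

/-- The theory generated by `T` and `φ`, by the deduction theorem. -/
theorem adjoin (hT : IsTheory T) (φ : Sentence) : IsTheory {ψ | φ.imp ψ ∈ T} where
  provable h := hT.mp (hT.provable (.imp_k _ _)) (hT.provable h)
  mp h₁ h₂ := hT.mp (hT.mp (hT.provable (.imp_s _ _ _)) h₁) h₂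

theorem subset_adjoin (hT : IsTheory T) (φ : Sentence) : T ⊆ {ψ | φ.imp ψ ∈ T} :=
  fun _ h => hT.mp (hT.provable (.imp_k _ _)) h

theorem and_mem_iff (hT : IsTheory T) {φ ψ : Sentence} : φ.and ψ ∈ T ↔ φ ∈ T ∧ ψ ∈ T :=
  ⟨fun h => ⟨hT.mp (hT.provable (.and_left _ _)) h, hT.mp (hT.provable (.and_right _ _)) h⟩,
    fun h => hT.mp (hT.mp (hT.provable (.and_intro _ _)) h.1) h.2⟩

/-- Lindenbaum's lemma: a theory that omits `χ` extends to a prime theory that omits `χ`. -/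
theorem exists_isPrimeTheory (hT : IsTheory T) {χ : Sentence} (hχ : χ ∉ T) :
    ∃ S, T ⊆ S ∧ IsPrimeTheory S ∧ χ ∉ S := by
  obtain ⟨S, hTS, hS⟩ := zorn_subset_nonempty {S | IsTheory S ∧ χ ∉ S} (by
    intro c hc hchain hne
    refine ⟨⋃₀ c, ⟨⟨fun h => ?_, ?_⟩, ?_⟩, fun s hs => Set.subset_sUnion_of_mem hs⟩
    · obtain ⟨s, hs⟩ := hne
      exact ⟨s, hs, (hc hs).1.provable h⟩
    · rintro φ ψ ⟨s, hs, h₁⟩ ⟨t, ht, h₂⟩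
      rcases hchain.total hs ht with hst | hts
      · exact ⟨t, ht, (hc ht).1.mp (hst h₁) h₂⟩
      · exact ⟨s, hs, (hc hs).1.mp h₁ (hts h₂)⟩
    · rintro ⟨s, hs, h⟩
      exact (hc hs).2 h) T ⟨hT, hχ⟩
  have hST : IsTheory S := hS.prop.1
  -- By maximality, adjoining any further sentence to `S` makes `χ` derivable.
  have key : ∀ φ, φ ∉ S → φ.imp χ ∈ S := by
    intro φ hφ
    by_contra h
    exact hφ (hS.le_of_ge (y := {ψ | φ.imp ψ ∈ S}) ⟨hST.adjoin φ, h⟩ (hST.subset_adjoin φ)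
      (hST.provable (.imp_self φ)))
  refine ⟨S, hTS, ⟨hST, ⟨χ, hS.prop.2⟩, fun {φ ψ} h => ?_⟩, hS.prop.2⟩
  by_contra! hn
  exact hS.prop.2 (hST.mp (hST.mp (hST.mp (hST.provable (.or_elim _ _ _)) (key φ hn.1))
    (key ψ hn.2)) h)

end IsTheory

namespace IsPrimeTheory

variable {T : Set Sentence}

theorem or_mem_iff (hT : IsPrimeTheory T) {φ ψ : Sentence} : φ.or ψ ∈ T ↔ φ ∈ T ∨ ψ ∈ T :=
  ⟨hT.prime, fun h => h.elim (hT.mp (hT.provable (.or_left _ _)))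
    (hT.mp (hT.provable (.or_right _ _)))⟩

theorem notMem_of_neg_mem (hT : IsPrimeTheory T) {φ : Sentence} (h : φ.neg ∈ T) : φ ∉ T := by
  obtain ⟨ψ, hψ⟩ := hT.ne_univ
  exact fun hφ => hψ (hT.mp (hT.mp (hT.provable (.neg_elim _ _)) h) hφ)

theorem exists_of_imp_notMem (hT : IsPrimeTheory T) {φ ψ : Sentence} (h : φ.imp ψ ∉ T) :
    ∃ S, T ⊆ S ∧ IsPrimeTheory S ∧ φ ∈ S ∧ ψ ∉ S := by
  obtain ⟨S, hTS, hS, hψ⟩ := (hT.adjoin φ).exists_isPrimeTheory (χ := ψ) h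
  exact ⟨S, (hT.subset_adjoin φ).trans hTS, hS, hTS (hT.provable (.imp_self φ)), hψ⟩

theorem exists_of_neg_notMem (hT : IsPrimeTheory T) {φ : Sentence} (h : φ.neg ∉ T) :
    ∃ S, T ⊆ S ∧ IsPrimeTheory S ∧ φ ∈ S := by
  obtain ⟨S, hTS, hS, hφ, -⟩ := hT.exists_of_imp_notMem (φ := φ) (ψ := φ.neg) fun h' =>
    h (hT.mp (hT.mp (hT.provable (.neg_intro _ _)) (hT.provable (.imp_self φ))) h')
  exact ⟨S, hTS, hS, hφ⟩

end IsPrimeTheory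

/-! ### Kripke forcing and the finite model property -/

/-- Kripke forcing on a frame `F`, where `V i` is the set of worlds at which `pᵢ` holds. -/
def Forces {F : Type*} [Preorder F] (V : ℕ → Set F) : F → Sentence → Prop
  | w, .atom i => w ∈ V i
  | w, .and φ ψ => Forces V w φ ∧ Forces V w ψ
  | w, .or φ ψ => Forces V w φ ∨ Forces V w ψ
  | w, .imp φ ψ => ∀ u, w ≤ u → Forces V u φ → Forces V u ψ
  | w, .neg φ => ∀ u, w ≤ u → ¬ Forces V u φ

/-- The set of subformulas of a sentence. -/
def Sentence.subformulas : Sentence → Set Sentence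
  | .atom i => {.atom i}
  | .and φ ψ => insert (φ.and ψ) (φ.subformulas ∪ ψ.subformulas)
  | .or φ ψ => insert (φ.or ψ) (φ.subformulas ∪ ψ.subformulas)
  | .imp φ ψ => insert (φ.imp ψ) (φ.subformulas ∪ ψ.subformulas)
  | .neg φ => insert φ.neg φ.subformulas

theorem Sentence.finite_subformulas (φ : Sentence) : φ.subformulas.Finite := by
  induction φ with
  | atom i => exact Set.finite_singleton _
  | and φ ψ h₁ h₂ => exact (h₁.union h₂).insert _
  | or φ ψ h₁ h₂ => exact (h₁.union h₂).insert _
  | imp φ ψ h₁ h₂ => exact (h₁.union h₂).insert _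
  | neg φ h => exact h.insert _

theorem Sentence.mem_subformulas_self (φ : Sentence) : φ ∈ φ.subformulas := by
  cases φ <;> simp [subformulas]

/-- The worlds of the filtration of the canonical model through a set `Γ` of sentences: the traces
on `Γ` of prime theories, restricted to those above the trace of `T₀`. -/
abbrev TraceFrame (Γ T₀ : Set Sentence) : Type :=
  {w : Set Sentence // T₀ ∩ Γ ⊆ w ∧ ∃ T, IsPrimeTheory T ∧ w = T ∩ Γ}

theorem finite_traceFrame {Γ : Set Sentence} (hΓ : Γ.Finite) (T₀ : Set Sentence) :
    Finite (TraceFrame Γ T₀) := by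
  refine (hΓ.finite_subsets.subset ?_).to_subtype
  rintro w ⟨-, T, -, rfl⟩
  exact Set.inter_subset_right

/-- The truth lemma for the filtration. -/
theorem forces_traceFrame_iff {Γ T₀ : Set Sentence} (φ : Sentence) (hφ : φ.subformulas ⊆ Γ)
    (w : TraceFrame Γ T₀) :
    Forces (fun i => {u : TraceFrame Γ T₀ | Sentence.atom i ∈ u.1}) w φ ↔ φ ∈ w.1 := by
  have hself := hφ φ.mem_subformulas_self
  -- A prime theory above `T` has a trace above the trace of `T`.
  have lift : ∀ {T S : Set Sentence} (h₀ : T₀ ∩ Γ ⊆ T ∩ Γ) (hTS : T ⊆ S) (hS : IsPrimeTheory S),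
      T₀ ∩ Γ ⊆ S ∩ Γ ∧ ∃ R, IsPrimeTheory R ∧ S ∩ Γ = R ∩ Γ := fun h₀ hTS hS =>
    ⟨h₀.trans (Set.inter_subset_inter_left _ hTS), _, hS, rfl⟩
  induction φ generalizing w with
  | atom i => rfl
  | and φ ψ ihφ ihψ =>
    obtain ⟨_, h₀, T, hT, rfl⟩ := w
    simp only [Sentence.subformulas, Set.insert_subset_iff, Set.union_subset_iff] at hφ
    have h₁ := hφ.2.1 φ.mem_subformulas_self
    have h₂ := hφ.2.2 ψ.mem_subformulas_self
    simp only [Forces, ihφ hφ.2.1 _ h₁, ihψ hφ.2.2 _ h₂, Set.mem_inter_iff, hT.and_mem_iff, h₁, h₂,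
      hself, and_true]
  | or φ ψ ihφ ihψ =>
    obtain ⟨_, h₀, T, hT, rfl⟩ := w
    simp only [Sentence.subformulas, Set.insert_subset_iff, Set.union_subset_iff] at hφ
    have h₁ := hφ.2.1 φ.mem_subformulas_self
    have h₂ := hφ.2.2 ψ.mem_subformulas_self
    simp only [Forces, ihφ hφ.2.1 _ h₁, ihψ hφ.2.2 _ h₂, Set.mem_inter_iff, hT.or_mem_iff, h₁, h₂,
      hself, and_true]
  | imp φ ψ ihφ ihψ =>
    obtain ⟨_, h₀, T, hT, rfl⟩ := w
    simp only [Sentence.subformulas, Set.insert_subset_iff, Set.union_subset_iff] at hφ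
    have h₁ := hφ.2.1 φ.mem_subformulas_self
    have h₂ := hφ.2.2 ψ.mem_subformulas_self
    simp only [Forces, ihφ hφ.2.1 _ h₁, ihψ hφ.2.2 _ h₂]
    constructor
    · intro h
      by_contra hn
      obtain ⟨S, hTS, hS, hφS, hψS⟩ := hT.exists_of_imp_notMem fun h' => hn ⟨h', hself⟩
      exact hψS (h ⟨S ∩ Γ, lift h₀ hTS hS⟩ (Set.inter_subset_inter_left _ hTS) ⟨hφS, h₁⟩).1
    · rintro h ⟨_, _, S, hS, rfl⟩ hu hφS
      exact ⟨hS.mp (hu h).1 hφS.1, h₂⟩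
  | neg φ ihφ =>
    obtain ⟨_, h₀, T, hT, rfl⟩ := w
    simp only [Sentence.subformulas, Set.insert_subset_iff] at hφ
    have h₁ := hφ.2 φ.mem_subformulas_self
    simp only [Forces, ihφ hφ.2 _ h₁]
    constructor
    · intro h
      by_contra hn
      obtain ⟨S, hTS, hS, hφS⟩ := hT.exists_of_neg_notMem fun h' => hn ⟨h', hself⟩
      exact h ⟨S ∩ Γ, lift h₀ hTS hS⟩ (Set.inter_subset_inter_left _ hTS) ⟨hφS, h₁⟩
    · rintro h ⟨_, _, S, hS, rfl⟩ hu hφS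
      exact hS.notMem_of_neg_mem (hu h).1 hφS.1

/-- The finite model property: an unprovable sentence is refuted at the least element of a finite
partial order, under a valuation by up-sets. -/
theorem exists_finite_countermodel {φ : Sentence} (hφ : ¬ Provable φ) :
    ∃ (F : Type) (_ : PartialOrder F) (_ : OrderBot F) (_ : Finite F) (V : ℕ → Set F),
      (∀ i, IsUpperSet (V i)) ∧ ¬ Forces V ⊥ φ := by
  obtain ⟨T₀, -, hT₀, hφT₀⟩ := isTheory_IPC.exists_isPrimeTheory hφ
  let b : OrderBot (TraceFrame φ.subformulas T₀) :=
    { bot := ⟨T₀ ∩ φ.subformulas, subset_rfl, T₀, hT₀, rfl⟩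
      bot_le := fun w => w.2.1 }
  exact ⟨TraceFrame φ.subformulas T₀, inferInstance, b,
    finite_traceFrame φ.finite_subformulas T₀, fun i => {u | Sentence.atom i ∈ u.1},
    fun i u w h hu => h hu,
    fun h => hφT₀ ((forces_traceFrame_iff φ subset_rfl _).1 h).1⟩

/-! ### Forcing in an interval of up-sets -/

section Interval

variable {P F : Type*} [PartialOrder P] [PartialOrder F]

theorem OpenSets.mem_himp_iff {A B : OpenSets P} {x : P} :
    x ∈ (A ⇨ B).1 ↔ ∀ y, x ≤ y → y ∈ A.1 → y ∈ B.1 := by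
  constructor
  · rintro ⟨C, ⟨hC, hAC⟩, hx⟩ y hxy hy
    exact hAC ⟨hy, hC hxy hx⟩
  · intro h
    exact ⟨Set.Ici x, ⟨isUpperSet_Ici x, fun y hy => h y hy.2 hy.1⟩, le_refl x⟩

/-- The preimage under `f` of a valuation `V` of a frame `F`, as a valuation in `O(P)[D, 1]`. Only
the values of `f` outside `D` matter. -/
def pullback (D : OpenSets P) (f : P → F) (hf : ∀ x y, x ≤ y → y ∉ D.1 → f x ≤ f y)
    (V : ℕ → Set F) (hV : ∀ i, IsUpperSet (V i)) (i : ℕ) : Set.Ici D :=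
  ⟨⟨D.1 ∪ f ⁻¹' V i, by
    rintro x y hxy (hx | hx)
    · exact .inl (D.2 hxy hx)
    · by_cases hy : y ∈ D.1
      · exact .inl hy
      · exact .inr (hV i (hf x y hxy hy) hx)⟩,
    Set.subset_union_left⟩

/-- If `f` is a p-morphism from `P ∖ D` to `F`, then the value of a sentence in `O(P)[D, 1]` consists
of `D` and the points whose image under `f` forces the sentence. -/
theorem mem_val_iff_forces (D : OpenSets P) (f : P → F)
    (hf : ∀ x y, x ≤ y → y ∉ D.1 → f x ≤ f y)
    (hback : ∀ x, x ∉ D.1 → ∀ w, f x ≤ w → ∃ y, x ≤ y ∧ y ∉ D.1 ∧ f y = w)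
    (V : ℕ → Set F) (hV : ∀ i, IsUpperSet (V i)) (φ : Sentence) {x : P} (hx : x ∉ D.1) :
    x ∈ (φ.val (pullback D f hf V hV)).1.1 ↔ Forces V (f x) φ := by
  induction φ generalizing x with
  | atom i => exact or_iff_right hx
  | and φ ψ ihφ ihψ => exact and_congr (ihφ hx) (ihψ hx)
  | or φ ψ ihφ ihψ => exact or_congr (ihφ hx) (ihψ hx)
  | imp φ ψ ihφ ihψ =>
    refine OpenSets.mem_himp_iff.trans ⟨fun h w hw hφ => ?_, fun h y hxy hφ => ?_⟩
    · obtain ⟨y, hxy, hy, rfl⟩ := hback x hx w hw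
      exact (ihψ hy).1 (h y hxy ((ihφ hy).2 hφ))
    · by_cases hy : y ∈ D.1
      · exact (ψ.val (pullback D f hf V hV)).2 hy
      · exact (ihψ hy).2 (h _ (hf x y hxy hy) ((ihφ hy).1 hφ))
  | neg φ ihφ =>
    refine OpenSets.mem_himp_iff.trans ⟨fun h w hw hφ => ?_, fun h y hxy hφ => ?_⟩
    · obtain ⟨y, hxy, hy, rfl⟩ := hback x hx w hw
      exact hy (h y hxy ((ihφ hy).2 hφ))
    · by_contra hy
      exact h _ (hf x y hxy hy) ((ihφ hy).1 hφ)

/-- A p-morphism from `P ∖ D` that attains a world refuting `φ` refutes `φ` in `O(P)[D, 1]`. -/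
theorem notMem_Th_of_not_forces (D : OpenSets P) (f : P → F)
    (hf : ∀ x y, x ≤ y → y ∉ D.1 → f x ≤ f y)
    (hback : ∀ x, x ∉ D.1 → ∀ w, f x ≤ w → ∃ y, x ≤ y ∧ y ∉ D.1 ∧ f y = w)
    (V : ℕ → Set F) (hV : ∀ i, IsUpperSet (V i)) {φ : Sentence} {x : P} (hx : x ∉ D.1)
    (hφ : ¬ Forces V (f x) φ) : φ ∉ Th (Set.Ici D) := by
  intro h
  refine hφ ((mem_val_iff_forces D f hf hback V hV φ hx).1 ?_)
  rw [h]
  exact Set.mem_univ x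

end Interval

/-! ### The order complex of a finite frame -/

section Chains

variable {F : Type*} [PartialOrder F] {n : ℕ} (e : F ↪ Fin n)

/-- The complements in `n` of the chains of `F`, where `F` is viewed as a subset of `n` by the
embedding `e`. -/
def chainComplements : Set (Set (Fin n)) :=
  {s | IsChain (· ≤ ·) (e ⁻¹' sᶜ) ∧ sᶜ ⊆ Set.range e}

variable {e}

theorem mem_chainComplements_of_subset {s t : Set (Fin n)} (h : t ⊆ s)
    (ht : t ∈ chainComplements e) : s ∈ chainComplements e :=
  ⟨ht.1.mono (Set.preimage_mono (Set.compl_subset_compl.2 h)),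
    (Set.compl_subset_compl.2 h).trans ht.2⟩

theorem univ_mem_chainComplements : Set.univ ∈ chainComplements e := by
  simp [chainComplements]

variable [OrderBot F]

open Classical in
variable (e) in
/-- The largest element of the chain with complement `s`, or `⊥` if that chain is empty. For `s`
not the complement of a chain the value is irrelevant. -/
noncomputable def chainTop (s : Set (Fin n)) : F :=
  if h : ∃ w, IsGreatest (insert ⊥ (e ⁻¹' sᶜ)) w then h.choose else ⊥

theorem chainTop_eq {s : Set (Fin n)} {w : F} (h : IsGreatest (insert ⊥ (e ⁻¹' sᶜ)) w) :
    chainTop e s = w := by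
  have h' : ∃ w, IsGreatest (insert ⊥ (e ⁻¹' sᶜ)) w := ⟨w, h⟩
  rw [chainTop, dif_pos h']
  exact h'.choose_spec.unique h

theorem chainTop_univ : chainTop e Set.univ = ⊥ :=
  chainTop_eq (by simp)

variable [Finite F]

theorem isGreatest_chainTop {s : Set (Fin n)} (hs : s ∈ chainComplements e) :
    IsGreatest (insert ⊥ (e ⁻¹' sᶜ)) (chainTop e s) := by
  obtain ⟨w, hw⟩ := (Set.toFinite (insert ⊥ (e ⁻¹' sᶜ))).exists_maximal ⟨⊥, Set.mem_insert _ _⟩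
  have hchain : IsChain (· ≤ ·) (insert ⊥ (e ⁻¹' sᶜ)) := hs.1.insert fun b _ _ => .inl bot_le
  have hg : IsGreatest (insert ⊥ (e ⁻¹' sᶜ)) w :=
    ⟨hw.prop, fun u hu => (hchain.total hu hw.prop).elim id fun h => hw.le_of_ge hu h⟩
  rwa [chainTop_eq hg]

theorem chainTop_le_chainTop {s t : Set (Fin n)} (h : t ⊆ s) (ht : t ∈ chainComplements e) :
    chainTop e s ≤ chainTop e t :=
  (isGreatest_chainTop ht).2 (Set.insert_subset_insert
    (Set.preimage_mono (Set.compl_subset_compl.2 h))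
    (isGreatest_chainTop (mem_chainComplements_of_subset h ht)).1)

/-- The back property of `chainTop`: a chain grows by any world above its largest element. -/
theorem exists_chainTop_eq {s : Set (Fin n)} (hs : s ∈ chainComplements e) {w : F}
    (hw : chainTop e s ≤ w) : ∃ t ⊆ s, t ∈ chainComplements e ∧ chainTop e t = w := by
  have hle : ∀ u ∈ e ⁻¹' sᶜ, u ≤ w := fun u hu =>
    ((isGreatest_chainTop hs).2 (Set.mem_insert_of_mem _ hu)).trans hw
  have hpre : e ⁻¹' (s \ {e w})ᶜ = insert w (e ⁻¹' sᶜ) := by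
    ext u
    simp only [Set.mem_preimage, Set.mem_compl_iff, Set.mem_sdiff, Set.mem_singleton_iff,
      e.injective.eq_iff, Set.mem_insert_iff]
    tauto
  refine ⟨s \ {e w}, Set.sdiff_subset, ⟨?_, ?_⟩, chainTop_eq ?_⟩
  · rw [hpre]
    exact hs.1.insert fun u hu _ => .inr (hle u hu)
  · intro j hj
    by_cases hjw : j = e w
    · exact ⟨w, hjw.symm⟩
    · exact hs.2 fun hjs => hj ⟨hjs, hjw⟩
  · rw [hpre]
    refine ⟨by simp, ?_⟩
    rintro u (rfl | rfl | hu)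
    · exact bot_le
    · exact le_rfl
    · exact hle u hu

end Chains

/-! ### Completeness -/

/-- A finite type embeds in some `n` with a vertex to spare. -/
theorem exists_embedding_fin (F : Type*) [Finite F] :
    ∃ n, 0 < n ∧ ∃ e : F ↪ Fin n, ∃ j, j ∉ Set.range e := by
  refine ⟨Nat.card F + 1, Nat.succ_pos _,
    (Finite.equivFin F).toEmbedding.trans Fin.castSuccEmb, Fin.last _, ?_⟩
  rintro ⟨w, hw⟩
  exact (Fin.castSucc_lt_last _).ne hw

theorem exists_openPow_notMem_Th {φ : Sentence} (hφ : ¬ Provable φ) :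
    ∃ n, 0 < n ∧ ∃ D : OpenPow n, φ ∉ Th (Set.Ici D) := by
  obtain ⟨F, _, _, _, V, hV, hF⟩ := exists_finite_countermodel hφ
  obtain ⟨n, hn, e, -⟩ := exists_embedding_fin F
  let D : OpenPow n := ⟨{s | OrderDual.ofDual s ∉ chainComplements e},
    fun _ _ h hs ht => hs (mem_chainComplements_of_subset h ht)⟩
  refine ⟨n, hn, D, notMem_Th_of_not_forces D (fun s => chainTop e (OrderDual.ofDual s)) ?_ ?_ V hV
    (x := OrderDual.toDual Set.univ) (not_not.2 univ_mem_chainComplements) ?_⟩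
  · exact fun s t h ht => chainTop_le_chainTop h (not_not.1 ht)
  · intro s hs w hw
    obtain ⟨t, hts, ht, htw⟩ := exists_chainTop_eq (not_not.1 hs) hw
    exact ⟨OrderDual.toDual t, hts, not_not.2 ht, htw⟩
  · simpa [chainTop_univ] using hF

theorem exists_openPowMinus_notMem_Th {φ : Sentence} (hφ : ¬ Provable φ) :
    ∃ n, 0 < n ∧ ∃ D : OpenPowMinus n, φ ∉ Th (Set.Ici D) := by
  obtain ⟨F, _, _, _, V, hV, hF⟩ := exists_finite_countermodel hφ
  obtain ⟨n, hn, e, j, hj⟩ := exists_embedding_fin F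
  -- The spare vertex `j` lies in the complement of every chain.
  have hne : ∀ s ∈ chainComplements e, s.Nonempty := fun s hs =>
    ⟨j, by_contra fun h => hj (hs.2 h)⟩
  let D : OpenPowMinus n := ⟨{s | (OrderDual.ofDual s).1 ∉ chainComplements e},
    fun _ _ h hs ht => hs (mem_chainComplements_of_subset h ht)⟩
  refine ⟨n, hn, D, notMem_Th_of_not_forces D (fun s => chainTop e (OrderDual.ofDual s).1) ?_ ?_ V hV
    (x := OrderDual.toDual ⟨Set.univ, hne _ univ_mem_chainComplements⟩)
    (not_not.2 univ_mem_chainComplements) ?_⟩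
  · exact fun s t h ht => chainTop_le_chainTop h (not_not.1 ht)
  · intro s hs w hw
    obtain ⟨t, hts, ht, htw⟩ := exists_chainTop_eq (not_not.1 hs) hw
    exact ⟨OrderDual.toDual ⟨t, hne t ht⟩, hts, not_not.2 ht, htw⟩
  · simpa [chainTop_univ] using hF

end IntProp

theorem mainTheorem3 :
    (⋂ (n : ℕ) (_ : 0 < n), ⋂ D : IntProp.OpenPow n, IntProp.Th (Set.Ici D)) = IntProp.IPC ∧
    IntProp.IPC =
      ⋂ (n : ℕ) (_ : 0 < n), ⋂ D : IntProp.OpenPowMinus n, IntProp.Th (Set.Ici D) := by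
  refine ⟨Set.Subset.antisymm (fun φ h => ?_) (fun φ h => ?_),
    Set.Subset.antisymm (fun φ h => ?_) (fun φ h => ?_)⟩
  · by_contra hφ
    obtain ⟨n, hn, D, hD⟩ := IntProp.exists_openPow_notMem_Th hφ
    simp only [Set.mem_iInter] at h
    exact hD (h n hn D)
  · simp only [Set.mem_iInter]
    exact fun n _ D v => IntProp.Provable.val_eq_top v h
  · simp only [Set.mem_iInter]
    exact fun n _ D v => IntProp.Provable.val_eq_top v h
  · by_contra hφ
    obtain ⟨n, hn, D, hD⟩ := IntProp.exists_openPowMinus_notMem_Th hφ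
    simp only [Set.mem_iInter] at h
    exact hD (h n hn D)
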